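/- Let $X$ be a quandle, i.e. a set with a binary operation $*$ such that $a*a=a$, each map $\bullet * b\colon X\to X$ is bijective, and $(a*b)*c=(a*c)*(b*c)$. Let $\mathrm{Inn}(X)$ be the group of permutations of $X$, acting from the right, generated by the maps $\bullet * y$ $(y\in X)$; $X$ is *connected* if this action is transitive. Let $\mathrm{Stab}(x)\subset\mathrm{Inn}(X)$ be the stabilizer of $x$. Let $\mathrm{Type}(X)\in\mathbb{N}\cup\{\infty\}$ be the least $n\ge 1$ with $(\cdots(x*y)\cdots)*y=x$ ($n$ times) for all $x,y\in X$. Let $\mathrm{As}(X)=\langle e_x\ (x\in X)\mid e_xe_y=e_ye_{x*y}\rangle$, let $\psi\colon\mathrm{As}(X)\to\mathrm{Inn}(X)$ be $e_x\mapsto \bullet * x$ (a surjection with central kernel), let $\widetilde{\mathrm{Stab}}(x)=\psi^{-1}(\mathrm{Stab}(x))$, and let $\epsilon\colon\mathrm{As}(X)\to\mathbb{Z}$ be $e_x\mapsto 1$. Let $A$ be an abelian group; all coefficients are trivial. $H^2_Q(X;A)$ is the group of maps $\phi\colon X^2\to A$ with $\phi(a,a)=0$ and $\phi(x,z)-\phi(x*y,z)-\phi(x,y)+\phi(x*z,y*z)=0$,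 modulo the maps $(x,y)\mapsto f(x)-f(x*y)$ for $f\colon X\to A$. For groups $K\subset G$, $H^*(G,K;A)$ is the cohomology of the complex $C^n(G,K;A)=\mathrm{Map}(G^n,A)\oplus\mathrm{Map}(K^{n-1},A)$ with $\partial(h,k)=(\partial h,\,h|_K-\partial k)$, where $\partial$ is the inhomogeneous group coboundary; $p^*\colon H^2(G,K;A)\to H^2(G;A)$ is $[(h,k)]\mapsto[h]$, and its kernel is the image of $H^1(K;A)\to H^2(G,K;A)$, $k\mapsto[(0,k)]$. Write $H^2(G,K;A)/H^1(K;A)$ for the quotient by this image. For $x_0\in X$ define a homomorphism $$\mathcal{T}\colon H^2_Q(X;A)\to \frac{H^2(\mathrm{Inn}(X),\mathrm{Stab}(x_0);A)}{H^1(\mathrm{Stab}(x_0);A)}$$ as the composite of the following two maps. (a) The map $H^2_Q(X;A)\to H^1(\widetilde{\mathrm{Stab}}(x_0);A)=\mathrm{Hom}(\widetilde{\mathrm{Stab}}(x_0),A)$ that sends $[\phi]$ to $$e_{x_1}^{\epsilon_1}\cdots e_{x_n}^{\epsilon_n}\mapsto\sum_{j=1}^n\epsilon_j\,\phi\Bigl(\bigl((\cdots(x_0*^{\epsilon_1}x_1)\cdots)*^{\epsilon_{j-1}}x_{j-1}\bigr)*^{\frac{\epsilon_j-1}{2}}x_j,\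 x_j\Bigr),\qquad \epsilon_j\in\{\pm1\}.$$ (b) The map $f\mapsto (p^*)^{-1}\bigl(\delta_1^*\bigl((\mathcal{P}^*f)|_{\mathrm{Ker}\,\psi}\bigr)\bigr)$, where $(\mathcal{P}^*f)(g)=f(g)-\epsilon(g)f(e_{x_0})$, and where $\delta_1^*\colon\mathrm{Hom}(\mathrm{Ker}\,\psi,A)\to H^2(\mathrm{Inn}(X);A)$ sends $F$ to the class of $(g,h)\mapsto F(\mathfrak{s}(g)\mathfrak{s}(h)\mathfrak{s}(gh)^{-1})$ for a set-theoretic section $\mathfrak{s}$ of $\psi$ (the class does not depend on $\mathfrak{s}$). **Theorem.** Let $X$ be a connected quandle, $x_0\in X$, and $A$ an abelian group. Let $\ell$ be a prime number coprime to $\mathrm{Type}(X)$; in particular $\mathrm{Type}(X)<\infty$. Write $M_{(\ell)}$ for the localization of an abelian group $M$ at the prime ideal $(\ell)$ of $\mathbb{Z}$, and suppose that $H^1(\mathrm{Stab}(x_0);A)_{(\ell)}=0$. Then the projection $$H^2(\mathrm{Inn}(X),\mathrm{Stab}(x_0);A)_{(\ell)}\to\Bigl(\frac{H^2(\mathrm{Inn}(X),\mathrm{Stab}(x_0);A)}{H^1(\mathrm{Stab}(x_0);A)}\Bigr)_{(\ell)}$$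 is bijective, and under this identification the localized map $\mathcal{T}_{(\ell)}$ is an isomorphism of $\mathbb{Z}_{(\ell)}$-modules $$\mathcal{T}_{(\ell)}\colon H^2_Q(X;A)_{(\ell)}\xrightarrow{\ \sim\ }H^2(\mathrm{Inn}(X),\mathrm{Stab}(x_0);A)_{(\ell)}.$$ -/

import Mathlib

namespace QuandleSchur

open MulOpposite

/-! ### Group cohomology with trivial coefficients, inhomogeneous cochains -/

section GroupCohomology

/-- `ker g / im f`, for composable maps `f`, `g` of abelian groups (with `g ∘ f = 0`). -/
abbrev Coh {L M N : Type*} [AddCommGroup L] [AddCommGroup M] [AddCommGroup N]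
    [Module ℤ L] [Module ℤ M] [Module ℤ N] (f : L →ₗ[ℤ] M) (g : M →ₗ[ℤ] N) : Type _ :=
  LinearMap.ker g ⧸ (LinearMap.range f).submoduleOf (LinearMap.ker g)

/-- The coboundary `Map(G, A) → Map(G², A)`. -/
def d1 (G A : Type*) [Group G] [AddCommGroup A] : (G → A) →ₗ[ℤ] (G → G → A) where
  toFun f := fun g h => f h - f (g * h) + f g
  map_add' f f' := by funext g h; simp only [Pi.add_apply]; abel
  map_smul' n f := by
    funext g h; simp only [Pi.smul_apply, smul_sub, smul_add, RingHom.id_apply]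

/-- The coboundary `Map(G², A) → Map(G³, A)`. -/
def d2 (G A : Type*) [Group G] [AddCommGroup A] : (G → G → A) →ₗ[ℤ] (G → G → G → A) where
  toFun f := fun g h k => f h k - f (g * h) k + f g (h * k) - f g h
  map_add' f f' := by funext g h k; simp only [Pi.add_apply]; abel
  map_smul' n f := by
    funext g h k; simp only [Pi.smul_apply, smul_sub, smul_add, RingHom.id_apply]

/-- `H¹(G; A)`. The coboundary `A → Map(G, A)` is zero since the action is trivial, so this is the
group of 1-cocycles, i.e. of homomorphisms `G → A`. -/
abbrev H1 (G A : Type*) [Group G] [AddCommGroup A] : Type _ := LinearMap.ker (d1 G A)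

/-- `H²(G; A)`. -/
abbrev H2 (G A : Type*) [Group G] [AddCommGroup A] : Type _ := Coh (d1 G A) (d2 G A)

variable {G Q A : Type*} [Group G] [Group Q] [AddCommGroup A]

theorem H1_mul (f : H1 G A) (g h : G) : f.1 (g * h) = f.1 g + f.1 h := by
  have := congrFun (congrFun (LinearMap.mem_ker.1 f.2) g) h
  simp only [d1, LinearMap.coe_mk, AddHom.coe_mk, Pi.zero_apply] at this
  rw [← sub_eq_zero, ← neg_eq_zero, ← this]; abel

theorem mem_H1 {f : G → A} (h : ∀ g k, f (g * k) = f g + f k) : f ∈ LinearMap.ker (d1 G A) := by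
  rw [LinearMap.mem_ker]; funext g k
  simp only [d1, LinearMap.coe_mk, AddHom.coe_mk, Pi.zero_apply, h]; abel

/-- The map `H¹(Q; A) → H¹(G; A)` induced by a homomorphism `G → Q`. -/
def H1map (A : Type*) [AddCommGroup A] (q : G →* Q) : H1 Q A →ₗ[ℤ] H1 G A where
  toFun f := ⟨fun g => f.1 (q g), mem_H1 fun g k => by rw [map_mul, H1_mul]⟩
  map_add' _ _ := rfl
  map_smul' _ _ := rfl

/-! #### Relative cohomology of a pair `K ≤ G`
`Cⁿ(G, K; A) = Map(Gⁿ, A) ⊕ Map(Kⁿ⁻¹, A)` with `∂(h, k) = (∂h, h|_K - ∂k)`. -/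

/-- `C¹(G, K; A) → C²(G, K; A)`; here `Map(K⁰, A) = A`, and `∂ : Map(K⁰, A) → Map(K, A)` is zero. -/
def relD1 (K : Subgroup G) (A : Type*) [AddCommGroup A] :
    ((G → A) × A) →ₗ[ℤ] ((G → G → A) × (K → A)) where
  toFun c := (d1 G A c.1, fun b => c.1 b)
  map_add' _ _ := by simp only [Prod.fst_add, map_add]; rfl
  map_smul' _ _ := by simp only [Prod.smul_fst, map_smul]; rfl

/-- `C²(G, K; A) → C³(G, K; A)`. -/
def relD2 (K : Subgroup G) (A : Type*) [AddCommGroup A] :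
    ((G → G → A) × (K → A)) →ₗ[ℤ] ((G → G → G → A) × (K → K → A)) where
  toFun c := (d2 G A c.1, fun b b' => c.1 b b' - d1 K A c.2 b b')
  map_add' c c' := by
    refine Prod.ext (by simp) ?_
    funext b b'; simp only [Prod.fst_add, Prod.snd_add, map_add, Pi.add_apply]; abel
  map_smul' n c := by
    refine Prod.ext (by simp) ?_
    funext b b'
    simp only [Prod.smul_fst, Prod.smul_snd, map_smul, Pi.smul_apply, smul_sub, RingHom.id_apply]

/-- The relative cohomology `H²(G, K; A)`. -/
abbrev H2rel (K : Subgroup G) (A : Type*) [AddCommGroup A] : Type _ := Coh (relD1 K A) (relD2 K A)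

/-- `p* : H²(G, K; A) → H²(G; A)`, `[(h, k)] ↦ [h]`. -/
def pStar (K : Subgroup G) (A : Type*) [AddCommGroup A] : H2rel K A →ₗ[ℤ] H2 G A :=
  Submodule.mapQ _ _
    ((LinearMap.fst ℤ (G → G → A) (K → A)).restrict
      (p := LinearMap.ker (relD2 K A)) (q := LinearMap.ker (d2 G A))
      (fun _ hc => congrArg Prod.fst hc))
    (by rintro ⟨c, hc⟩ ⟨f, hf⟩; exact ⟨f.1, congrArg Prod.fst hf⟩)

/-- `H¹(K; A) → H²(G, K; A)`, `k ↦ [(0, k)]`, the map preceding `p*` in the long exact sequence. -/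
def relDelta (K : Subgroup G) (A : Type*) [AddCommGroup A] : H1 K A →ₗ[ℤ] H2rel K A :=
  Submodule.mkQ _ ∘ₗ
    ((LinearMap.inr ℤ (G → G → A) (K → A)).restrict
      (p := LinearMap.ker (d1 K A)) (q := LinearMap.ker (relD2 K A))
      (fun k hk => by
        rw [LinearMap.mem_ker] at hk ⊢
        refine Prod.ext (map_zero _) ?_
        funext b b'
        change (0 : A) - d1 K A k b b' = 0
        rw [hk]; simp))

/-- `H²(G, K; A) / H¹(K; A)`: the quotient by the image of `H¹(K; A) → H²(G, K; A)`. -/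
abbrev H2relQuot (K : Subgroup G) (A : Type*) [AddCommGroup A] : Type _ :=
  H2rel K A ⧸ LinearMap.range (relDelta K A)

/-- The map `H²(G, K; A) / H¹(K; A) → H²(G; A)` induced by `p*`. -/
def pBar (K : Subgroup G) (A : Type*) [AddCommGroup A] : H2relQuot K A →ₗ[ℤ] H2 G A :=
  Submodule.liftQ _ (pStar K A) (by
    rintro _ ⟨k, rfl⟩
    refine (Submodule.Quotient.mk_eq_zero _).2 ?_
    exact ⟨0, map_zero _⟩)

theorem pBar_injective (K : Subgroup G) (A : Type*) [AddCommGroup A] :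
    Function.Injective (pBar K A) := by
  rw [← LinearMap.ker_eq_bot, LinearMap.ker_eq_bot']
  intro m hm
  obtain ⟨m, rfl⟩ := Submodule.Quotient.mk_surjective _ m
  obtain ⟨⟨⟨h, k⟩, hc⟩, rfl⟩ := Submodule.Quotient.mk_surjective _ m
  obtain ⟨f, hf⟩ := (Submodule.Quotient.mk_eq_zero _).1 hm
  change d1 G A f = h at hf
  have hk : (fun b b' : K => h b b' - d1 K A k b b') = 0 := congrArg Prod.snd hc
  refine (Submodule.Quotient.mk_eq_zero _).2 ⟨⟨fun b => k b - f b, mem_H1 fun b b' => ?_⟩, ?_⟩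
  · have := congrFun (congrFun hk b) b'
    rw [← hf] at this
    simp only [d1, LinearMap.coe_mk, AddHom.coe_mk, Pi.zero_apply] at this
    rw [← sub_eq_zero, ← this, Subgroup.coe_mul]; abel
  · refine (Submodule.Quotient.eq _).2 ⟨(-f, 0), ?_⟩
    refine Prod.ext ?_ ?_
    · change d1 G A (-f) = 0 - h
      rw [map_neg, hf]; simp
    · funext b
      change - f b = (k b - f b) - k b
      abel

/-! #### The five-term exact sequence of a central extension -/

section Transgression

variable (q : G →* Q) (hq : Function.Surjective q) (hc : q.ker ≤ Subgroup.center G)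

/-- `s(g) s(h) s(gh)⁻¹ ∈ Ker q`, for a set-theoretic section `s` of `q`. -/
noncomputable def factorSet (g h : Q) : q.ker :=
  ⟨Function.surjInv hq g * Function.surjInv hq h * (Function.surjInv hq (g * h))⁻¹, by
    simp [MonoidHom.mem_ker, Function.surjInv_eq]⟩

theorem factorSet_cocycle {G Q : Type*} [Group G] [Group Q] (q : G →* Q)
    (hq : Function.Surjective q) (hc : q.ker ≤ Subgroup.center G) (g h k : Q) :
    factorSet q hq h k * factorSet q hq g (h * k) = factorSet q hq (g * h) k * factorSet q hq g h := by
  apply Subtype.ext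
  have h1 := (Subgroup.mem_center_iff.1 (hc (factorSet q hq h k).2)) (Function.surjInv hq g)
  have h2 := (Subgroup.mem_center_iff.1 (hc (factorSet q hq g h).2))
    (factorSet q hq (g * h) k : G)
  rw [Subgroup.coe_mul, Subgroup.coe_mul, h2]
  have e : (factorSet q hq g (h * k) : G) = Function.surjInv hq g *
    (Function.surjInv hq (h * k) * (Function.surjInv hq (g * (h * k)))⁻¹) := by
    simp [factorSet, mul_assoc]
  rw [e, ← mul_assoc, ← h1]
  simp [factorSet, mul_assoc]

/-- `δ₁* : Hom(Ker q, A) → H²(Q; A)` of a central extension `Ker q → G → Q`: the class of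
`(g, h) ↦ F(s(g) s(h) s(gh)⁻¹)` (this class does not depend on the section `s`). -/
noncomputable def transgression (A : Type*) [AddCommGroup A] : H1 q.ker A →ₗ[ℤ] H2 Q A :=
  Submodule.mkQ _ ∘ₗ
    { toFun := fun F => (⟨fun g h => F.1 (factorSet q hq g h), by
        rw [LinearMap.mem_ker]; funext g h k
        have := congrArg F.1 (factorSet_cocycle q hq hc g h k)
        rw [H1_mul, H1_mul] at this
        simp only [d2, LinearMap.coe_mk, AddHom.coe_mk, Pi.zero_apply]
        rw [← sub_eq_zero] at this
        rw [← this]; abel⟩ : LinearMap.ker (d2 Q A))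
      map_add' := fun _ _ => rfl
      map_smul' := fun _ _ => rfl }

/-- A homomorphism on `Ker q` that extends to the preimage of `K ≤ Q` has a transgression that
vanishes on `K`, i.e. comes from `H²(Q, K; A)`. -/
theorem transgression_mem (K : Subgroup Q) (f : H1 (K.comap q) A)
    (hK : q.ker ≤ K.comap q) :
    transgression q hq hc A (H1map A (Subgroup.inclusion hK) f) ∈ LinearMap.range (pBar K A) := by
  let s : K → K.comap q := fun b => ⟨Function.surjInv hq (b : Q), by
    rw [Subgroup.mem_comap, Function.surjInv_eq hq]; exact b.2⟩
  let h : Q → Q → A := fun g g' =>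
    f.1 (Subgroup.inclusion hK (factorSet q hq g g'))
  have hh : h ∈ LinearMap.ker (d2 Q A) := by
    rw [LinearMap.mem_ker]; funext g g' k
    have := congrArg (H1map A (Subgroup.inclusion hK) f).1 (factorSet_cocycle q hq hc g g' k)
    rw [H1_mul, H1_mul] at this
    simp only [d2, LinearMap.coe_mk, AddHom.coe_mk, Pi.zero_apply]
    rw [← sub_eq_zero] at this
    rw [← this]
    change h g' k - h (g * g') k + h g (g' * k) - h g g' = h g' k + h g (g' * k) -
      (h (g * g') k + h g g')
    abel
  have hc' : ((h, fun b => f.1 (s b)) : (Q → Q → A) × (K → A)) ∈ LinearMap.ker (relD2 K A) := by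
    rw [LinearMap.mem_ker]
    refine Prod.ext hh ?_
    funext b b'
    change h b b' - (f.1 (s b') - f.1 (s (b * b')) + f.1 (s b)) = 0
    have e : Subgroup.inclusion hK (factorSet q hq b b') * s (b * b') = s b * s b' := by
      apply Subtype.ext
      simp [factorSet, s]
    have := congrArg f.1 e
    rw [H1_mul, H1_mul] at this
    rw [← sub_eq_zero] at this
    rw [← this]
    change h b b' - _ = h b b' + _ - _
    abel
  exact ⟨Submodule.Quotient.mk (Submodule.Quotient.mk ⟨_, hc'⟩), rfl⟩

end Transgression

end GroupCohomology

/-! ### Quandles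
Mathlib's `y ◃ x` is written `x ⋆ y` here: idempotent, right self-distributive, and
`x ↦ x ⋆ y` is a bijection for each `y`. -/

section Quandles

/-- The right-handed quandle operation. -/
abbrev rop {X : Type*} [Quandle X] (x y : X) : X := Shelf.act y x

local infixl:70 " ⋆ " => rop

variable {X : Type*} [Quandle X] {A : Type*} [AddCommGroup A]

/-- The group of permutations of `X` acting from the right (`g * h` means: first `g`, then `h`)
contains the translation `• ⋆ y`. -/
def translation (y : X) : (Equiv.Perm X)ᵐᵒᵖ := op (Rack.act' y)

/-- The inner automorphism group: the group of (right-acting) permutations of `X` generated by the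
maps `• ⋆ y`. -/
def Inn (X : Type*) [Quandle X] : Subgroup (Equiv.Perm X)ᵐᵒᵖ :=
  Subgroup.closure (Set.range translation)

/-- The right action of `Inn X` on `X`. -/
def innAct (x : X) (g : Inn X) : X := g.1.unop x

theorem innAct_mul (x : X) (g h : Inn X) : innAct x (g * h) = innAct (innAct x g) h := rfl

theorem innAct_one (x : X) : innAct x 1 = x := rfl

/-- `X` is connected: `Inn X` acts transitively. -/
def IsConnectedQuandle (X : Type*) [Quandle X] : Prop := ∀ x y : X, ∃ g : Inn X, innAct x g = y

/-- The stabilizer of `x` in `Inn X`. -/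
def Stab (x : X) : Subgroup (Inn X) where
  carrier := {g | innAct x g = x}
  one_mem' := rfl
  mul_mem' {g h} hg hh := by
    simp only [Set.mem_ofPred_eq] at *
    rw [innAct_mul, hg, hh]
  inv_mem' {g} hg := by
    simp only [Set.mem_ofPred_eq] at *
    conv_lhs => rw [← hg]
    rw [← innAct_mul, mul_inv_cancel, innAct_one]

/-- `Type(X)`: the least `n ≥ 1` with `(⋯(x ⋆ y)⋯) ⋆ y = x` (`n` times) for all `x, y`, and `0` if
there is none, i.e. if the type is infinite (no prime is coprime to `0`). -/
noncomputable def type (X : Type*) [Quandle X] : ℕ :=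
  sInf {n : ℕ | 0 < n ∧ ∀ x y : X, (fun z => z ⋆ y)^[n] x = x}

/-- The relators of the associated group: `e_x e_y = e_y e_{x ⋆ y}`. -/
def asRels (X : Type*) [Quandle X] : Set (FreeGroup X) :=
  {r | ∃ x y : X, r = FreeGroup.of x * FreeGroup.of y *
    (FreeGroup.of y * FreeGroup.of (x ⋆ y))⁻¹}

/-- The associated group `As(X) = ⟨e_x (x ∈ X) | e_x e_y = e_y e_{x ⋆ y}⟩`. -/
abbrev As (X : Type*) [Quandle X] : Type _ := PresentedGroup (asRels X)

/-- The generator `e_x`. -/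
def gen (x : X) : As X := PresentedGroup.of x

theorem gen_mul (x y : X) : gen x * gen y = gen y * gen (x ⋆ y) := by
  have h : (PresentedGroup.mk (asRels X)) (FreeGroup.of x * FreeGroup.of y *
    (FreeGroup.of y * FreeGroup.of (x ⋆ y))⁻¹) = 1 :=
    PresentedGroup.one_of_mem ⟨x, y, rfl⟩
  rw [map_mul, map_inv, mul_inv_eq_one] at h
  exact h

/-- The homomorphism from `As X` determined by a map on generators. -/
def asLift {H : Type*} [Group H] (f : X → H) (hf : ∀ x y, f x * f y = f y * f (x ⋆ y)) :
    As X →* H :=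
  PresentedGroup.toGroup (f := f) (by
    rintro _ ⟨x, y, rfl⟩
    simp only [map_mul, map_inv, FreeGroup.lift_apply_of]
    rw [mul_inv_eq_one]; exact hf x y)

theorem asLift_gen {H : Type*} [Group H] (f : X → H) (hf : ∀ x y, f x * f y = f y * f (x ⋆ y))
    (x : X) : asLift f hf (gen x) = f x := PresentedGroup.toGroup.of _

theorem translation_rel (x y : X) :
    translation x * translation y = translation y * translation (x ⋆ y) := by
  apply unop_injective
  apply Equiv.ext
  intro z
  change Shelf.act y (Shelf.act x z) = Shelf.act (Shelf.act y x) (Shelf.act y z)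
  exact Shelf.self_distrib

/-- `ψ : As X → Inn X`, `e_x ↦ (• ⋆ x)`. Through `ψ`, `As X` acts on `X` from the right. -/
def psi (X : Type*) [Quandle X] : As X →* Inn X :=
  asLift (fun x => ⟨translation x, Subgroup.subset_closure ⟨x, rfl⟩⟩)
    (fun x y => Subtype.ext (translation_rel x y))

theorem psi_gen (x : X) :
    psi X (gen x) = ⟨translation x, Subgroup.subset_closure ⟨x, rfl⟩⟩ := asLift_gen _ _ x

theorem psi_surjective (X : Type*) [Quandle X] : Function.Surjective (psi X) := by
  rintro ⟨g, hg⟩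
  have : Inn X ≤ (psi X).range.map (Inn X).subtype := by
    refine (Subgroup.closure_le _).2 ?_
    rintro _ ⟨x, rfl⟩
    exact ⟨_, ⟨gen x, psi_gen x⟩, rfl⟩
  obtain ⟨_, ⟨a, rfl⟩, h⟩ := this hg
  exact ⟨a, Subtype.ext h⟩

theorem as_induction {P : As X → Prop} (one : P 1) (mul : ∀ g h, P g → P h → P (g * h))
    (of : ∀ x, P (gen x)) (inv : ∀ x, P (gen x)⁻¹) (g : As X) : P g := by
  obtain ⟨w, rfl⟩ := PresentedGroup.mk_surjective _ g
  induction w using FreeGroup.induction_on with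
  | C1 => exact one
  | of x => exact of x
  | inv_of x _ => exact inv x
  | mul x y hx hy => rw [map_mul]; exact mul _ _ hx hy

theorem gen_act (x : X) (g : As X) : gen x * g = g * gen (innAct x (psi X g)) := by
  revert x
  refine as_induction (P := fun g => ∀ x, gen x * g = g * gen (innAct x (psi X g))) ?_ ?_ ?_ ?_ g
  · intro x; simp [innAct_one]
  · intro g h hg hh x
    rw [map_mul, innAct_mul, ← mul_assoc, hg, mul_assoc, hh, mul_assoc]
  · intro y x
    rw [psi_gen]; exact gen_mul x y
  · intro y x
    have h := gen_mul (innAct x (psi X (gen y)⁻¹)) y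
    have e : innAct x (psi X (gen y)⁻¹) ⋆ y = x := by
      have : innAct (innAct x (psi X (gen y)⁻¹)) (psi X (gen y)) = x := by
        rw [← innAct_mul, ← map_mul, inv_mul_cancel, map_one, innAct_one]
      rw [psi_gen] at this
      exact this
    rw [e] at h
    rw [eq_inv_mul_iff_mul_eq, ← mul_assoc, ← h, mul_assoc, mul_inv_cancel, mul_one]

theorem psi_ker_central (X : Type*) [Quandle X] : (psi X).ker ≤ Subgroup.center (As X) := by
  intro k hk
  rw [Subgroup.mem_center_iff]
  intro g
  have key : ∀ x : X, gen x * k = k * gen x := fun x => by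
    have := gen_act x k
    rwa [(MonoidHom.mem_ker).1 hk, innAct_one] at this
  refine as_induction (P := fun g => g * k = k * g) (by simp) ?_ key ?_ g
  · intro g h hg hh
    rw [mul_assoc, hh, ← mul_assoc, hg, mul_assoc]
  · intro x
    rw [inv_mul_eq_iff_eq_mul, ← mul_assoc, key x, mul_assoc, mul_inv_cancel, mul_one]

/-- The stabilizer of `x` in `As X`. -/
abbrev StabAs (x : X) : Subgroup (As X) := (Stab x).comap (psi X)

theorem ker_le_StabAs (x : X) : (psi X).ker ≤ StabAs x := fun g hg => by
  rw [Subgroup.mem_comap, (MonoidHom.mem_ker).1 hg]; exact one_mem _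

theorem gen_mem_StabAs (x : X) : gen x ∈ StabAs x := by
  rw [Subgroup.mem_comap, psi_gen]
  exact Quandle.fix

/-- `ε : As X → ℤ`, `e_x ↦ 1`. -/
def epsilon (X : Type*) [Quandle X] : As X →* Multiplicative ℤ :=
  asLift (fun _ => Multiplicative.ofAdd 1) (fun _ _ => rfl)

/-- The dual `𝒫* : H¹(Stab~(x); A) → H¹(Stab~(x); A)` of the projection
`[g] ↦ [g] - ε(g) [e_x]` of `H₁(Stab~(x); ℤ)` that kills the class of `e_x` and, for `X` connected,
has image the kernel of `H₁(Stab~(x); ℤ) → H₁(As X; ℤ) = ℤ`. -/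
def projStar (x : X) (A : Type*) [AddCommGroup A] : H1 (StabAs x) A →ₗ[ℤ] H1 (StabAs x) A where
  toFun f := ⟨fun g => f.1 g - (epsilon X g).toAdd • f.1 ⟨gen x, gen_mem_StabAs x⟩, mem_H1 (by
    intro g h
    rw [H1_mul, Subgroup.coe_mul, map_mul, toAdd_mul, add_smul]; abel)⟩
  map_add' f f' := by
    apply Subtype.ext; funext g
    simp only [Submodule.coe_add, Pi.add_apply, smul_add]; abel
  map_smul' n f := by
    apply Subtype.ext; funext g
    simp only [Submodule.coe_smul, Pi.smul_apply, smul_sub, RingHom.id_apply]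
    rw [smul_comm]

/-- `𝒯 = (p*)⁻¹ ∘ δ₁* ∘ (res ψ)* ∘ 𝒫* : H¹(Stab~(x); A) → H²(Inn X, Stab x; A) / H¹(Stab x; A)`. -/
noncomputable def TStab (x : X) (A : Type*) [AddCommGroup A] :
    H1 (StabAs x) A →ₗ[ℤ] H2relQuot (Stab x) A :=
  (LinearEquiv.ofInjective (pBar (Stab x) A) (pBar_injective (Stab x) A)).symm.toLinearMap ∘ₗ
    LinearMap.codRestrict (LinearMap.range (pBar (Stab x) A))
      (transgression (psi X) (psi_surjective X) (psi_ker_central X) A ∘ₗ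
        H1map A (Subgroup.inclusion (ker_le_StabAs x)) ∘ₗ projStar x A)
      (fun f => transgression_mem (psi X) (psi_surjective X) (psi_ker_central X) (Stab x)
        (projStar x A f) (ker_le_StabAs x))

/-! #### Second quandle cohomology -/

/-- Quandle 2-cochains: maps `X² → A` that vanish on the diagonal. -/
def C2Q (X A : Type*) [AddCommGroup A] : Submodule ℤ (X → X → A) where
  carrier := {φ | ∀ a, φ a a = 0}
  zero_mem' _ := rfl
  add_mem' {φ φ'} h h' a := by simp [h a, h' a]
  smul_mem' n φ h a := by simp [h a]

/-- The dual of `∂₂(x, y) = (x) - (x ⋆ y)`. -/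
def dQ1 (X A : Type*) [Quandle X] [AddCommGroup A] : (X → A) →ₗ[ℤ] C2Q X A where
  toFun f := ⟨fun x y => f x - f (x ⋆ y), fun a => by
    change f a - f (Shelf.act a a) = 0
    rw [Quandle.fix, sub_self]⟩
  map_add' f f' := by
    apply Subtype.ext; funext x y
    simp only [Submodule.coe_add, Pi.add_apply]; abel
  map_smul' n f := by
    apply Subtype.ext; funext x y
    simp only [Submodule.coe_smul, Pi.smul_apply, smul_sub, RingHom.id_apply]

/-- The dual of `∂₃(x, y, z) = (x, z) - (x ⋆ y, z) - (x, y) + (x ⋆ z, y ⋆ z)`. -/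
def dQ2 (X A : Type*) [Quandle X] [AddCommGroup A] : C2Q X A →ₗ[ℤ] (X → X → X → A) where
  toFun φ := fun x y z => φ.1 x z - φ.1 (x ⋆ y) z - φ.1 x y + φ.1 (x ⋆ z) (y ⋆ z)
  map_add' f f' := by
    funext x y z
    simp only [Submodule.coe_add, Pi.add_apply]; abel
  map_smul' n f := by
    funext x y z
    simp only [Submodule.coe_smul, Pi.smul_apply, smul_sub, smul_add, RingHom.id_apply]

/-- The second quandle cohomology `H²_Q(X; A)`. -/
abbrev H2Q (X A : Type*) [Quandle X] [AddCommGroup A] : Type _ := Coh (dQ1 X A) (dQ2 X A)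

/-- For `φ : X² → A`, the permutation `(x, a) ↦ (x ⋆ y, a + φ(x, y))` of `X × A`. -/
def extTranslation (φ : X → X → A) (y : X) : Equiv.Perm (X × A) where
  toFun p := (p.1 ⋆ y, p.2 + φ p.1 y)
  invFun p := ((Rack.act' y).symm p.1, p.2 - φ ((Rack.act' y).symm p.1) y)
  left_inv p := by
    have h : (Rack.act' y).symm (p.1 ⋆ y) = p.1 := (Rack.act' y).symm_apply_apply p.1
    simp only [h, add_sub_cancel_right]
  right_inv p := by
    have : (Rack.act' y).symm p.1 ⋆ y = p.1 := (Rack.act' y).apply_symm_apply p.1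
    simp only [this, sub_add_cancel]

/-- For a cocycle `φ`, the right action of `As X` on `X × A` by `(x, a) e_y = (x ⋆ y, a + φ(x, y))`;
consequently `(x, a) e_y⁻¹ = (x ⋆⁻¹ y, a - φ(x ⋆⁻¹ y, y))`. -/
def extAct (φ : LinearMap.ker (dQ2 X A)) : As X →* (Equiv.Perm (X × A))ᵐᵒᵖ :=
  asLift (fun y => op (extTranslation φ.1.1 y)) (fun x y => by
    apply unop_injective
    apply Equiv.ext
    rintro ⟨z, a⟩
    have h : φ.1.1 z y - φ.1.1 (z ⋆ x) y - φ.1.1 z x + φ.1.1 (z ⋆ y) (x ⋆ y) = 0 :=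
      congrFun (congrFun (congrFun (LinearMap.mem_ker.1 φ.2) z) x) y
    refine Prod.ext (Shelf.self_distrib) ?_
    change a + φ.1.1 z x + φ.1.1 (z ⋆ x) y = a + φ.1.1 z y + φ.1.1 (z ⋆ y) (x ⋆ y)
    rw [← sub_eq_zero, ← neg_eq_zero, ← h]; abel)

/-- The sum of the values of `φ` along a word for `g`, started at `x`: for
`g = e_{x₁}^{ε₁} ⋯ e_{xₙ}^{εₙ}` it is the sum over `j` of `εⱼ φ(yⱼ, xⱼ)`, where
`yⱼ = (⋯(x ⋆^{ε₁} x₁)⋯) ⋆^{εⱼ₋₁} xⱼ₋₁` if `εⱼ = 1`, and this followed by `⋆⁻¹ xⱼ` if `εⱼ = -1`. -/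
def walk (φ : LinearMap.ker (dQ2 X A)) (x : X) (g : As X) : A := ((extAct φ g).unop (x, 0)).2

theorem extAct_apply (φ : LinearMap.ker (dQ2 X A)) (g : As X) (x : X) (a : A) :
    (extAct φ g).unop (x, a) = (innAct x (psi X g), a + walk φ x g) := by
  have key : ∀ (g : As X) (p : X × A), ((extAct φ g).unop p).1 = innAct p.1 (psi X g) ∧
      ∀ b, (extAct φ g).unop (p.1, p.2 + b) =
        (((extAct φ g).unop p).1, ((extAct φ g).unop p).2 + b) := by
    intro g
    refine as_induction (P := fun g => ∀ p : X × A,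
      ((extAct φ g).unop p).1 = innAct p.1 (psi X g) ∧ ∀ b, (extAct φ g).unop (p.1, p.2 + b) =
        (((extAct φ g).unop p).1, ((extAct φ g).unop p).2 + b)) ?_ ?_ ?_ ?_ g
    · intro p; simp [innAct_one]
    · intro g h hg hh p
      simp only [map_mul, unop_mul, Equiv.Perm.mul_apply, innAct_mul]
      refine ⟨by rw [(hh _).1, (hg _).1], fun b => ?_⟩
      rw [(hg p).2 b, (hh _).2 b]
    · intro y p
      rw [psi_gen, extAct, asLift_gen]
      refine ⟨rfl, fun b => Prod.ext rfl ?_⟩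
      change p.2 + b + φ.1.1 p.1 y = p.2 + φ.1.1 p.1 y + b
      abel
    · intro y p
      rw [map_inv, map_inv, psi_gen, extAct, asLift_gen]
      refine ⟨rfl, fun b => Prod.ext rfl ?_⟩
      change p.2 + b - φ.1.1 ((Rack.act' y).symm p.1) y =
        p.2 - φ.1.1 ((Rack.act' y).symm p.1) y + b
      abel
  have h := (key g (x, 0)).2 a
  simp only [zero_add] at h
  rw [h, (key g (x, 0)).1, add_comm a]; rfl

theorem walk_mul (φ : LinearMap.ker (dQ2 X A)) (x : X) (g h : As X) :
    walk φ x (g * h) = walk φ x g + walk φ (innAct x (psi X g)) h := by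
  have : (extAct φ (g * h)).unop (x, 0) = (extAct φ h).unop ((extAct φ g).unop (x, 0)) := by
    rw [map_mul]; rfl
  rw [walk, this, extAct_apply, extAct_apply, zero_add]

theorem walk_one (φ : LinearMap.ker (dQ2 X A)) (x : X) : walk φ x 1 = 0 := by
  rw [walk, map_one]; rfl

theorem walk_gen (φ : LinearMap.ker (dQ2 X A)) (x y : X) : walk φ x (gen y) = φ.1.1 x y := by
  rw [walk, extAct, asLift_gen]; exact zero_add _

theorem walk_inv (φ : LinearMap.ker (dQ2 X A)) (x y : X) :
    walk φ x (gen y)⁻¹ = - φ.1.1 ((Rack.act' y).symm x) y := by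
  rw [walk, map_inv, extAct, asLift_gen]; exact zero_sub _

theorem walk_add (φ φ' : LinearMap.ker (dQ2 X A)) (x : X) (g : As X) :
    walk (φ + φ') x g = walk φ x g + walk φ' x g := by
  revert x
  refine as_induction (P := fun g => ∀ x, walk (φ + φ') x g = walk φ x g + walk φ' x g)
    ?_ ?_ ?_ ?_ g
  · intro x; simp [walk_one]
  · intro g h hg hh x; simp only [walk_mul, hg, hh]; abel
  · intro y x; simp only [walk_gen]; rfl
  · intro y x; simp only [walk_inv]; exact neg_add _ _

theorem walk_coboundary (φ : LinearMap.ker (dQ2 X A)) (f : X → A) (hf : dQ1 X A f = φ.1) (x : X)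
    (g : As X) : walk φ x g = f x - f (innAct x (psi X g)) := by
  have hφ : ∀ x y, φ.1.1 x y = f x - f (x ⋆ y) := fun x y => by rw [← hf]; rfl
  revert x
  refine as_induction (P := fun g => ∀ x, walk φ x g = f x - f (innAct x (psi X g)))
    ?_ ?_ ?_ ?_ g
  · intro x; simp [walk_one, innAct_one]
  · intro g h hg hh x; rw [walk_mul, hg, hh, map_mul, innAct_mul]; abel
  · intro y x; rw [walk_gen, hφ, psi_gen]; rfl
  · intro y x
    rw [walk_inv, hφ, map_inv, psi_gen]
    have : (Rack.act' y).symm x ⋆ y = x := (Rack.act' y).apply_symm_apply x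
    rw [this, neg_sub]; rfl

/-- The homomorphism `H²_Q(X; A) → H¹(Stab~(x); A)` sending `[φ]` to `g ↦ walk φ x g`. -/
def quandleToStab (x : X) (A : Type*) [AddCommGroup A] : H2Q X A →ₗ[ℤ] H1 (StabAs x) A :=
  Submodule.liftQ _
    (AddMonoidHom.toIntLinearMap
      { toFun := fun φ => (⟨fun g => walk φ x g, mem_H1 (fun g h => by
          rw [Subgroup.coe_mul, walk_mul, show innAct x (psi X g.1) = x from g.2])⟩ :
            H1 (StabAs x) A)
        map_zero' := Subtype.ext (funext fun g => by
          have := walk_add (0 : LinearMap.ker (dQ2 X A)) 0 x g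
          rw [add_zero] at this
          exact left_eq_add.1 this)
        map_add' := fun φ φ' => Subtype.ext (funext fun g => walk_add φ φ' x g) })
    (by
      rintro φ ⟨f, hf⟩
      refine LinearMap.mem_ker.2 (Subtype.ext (funext fun g => ?_))
      change walk φ x g = 0
      rw [walk_coboundary φ f hf, show innAct x (psi X g.1) = x from g.2, sub_self])

/-- The homomorphism `𝒯 : H²_Q(X; A) → H²(Inn X, Stab x; A) / H¹(Stab x; A)`. -/
noncomputable def T (x : X) (A : Type*) [AddCommGroup A] :
    H2Q X A →ₗ[ℤ] H2relQuot (Stab x) A :=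
  TStab x A ∘ₗ quandleToStab x A

end Quandles

/-! ### Localization at a prime number -/

section Localization

instance span_isPrime (l : ℕ) [hl : Fact l.Prime] : (Ideal.span {(l : ℤ)}).IsPrime :=
  (Ideal.span_singleton_prime (by exact_mod_cast hl.out.ne_zero)).2
    (Nat.prime_iff_prime_int.1 hl.out)

/-- The localization `M_(ℓ)` of an abelian group at the prime ideal `(ℓ)` of `ℤ`. -/
abbrev Loc (l : ℕ) [Fact l.Prime] (M : Type*) [AddCommGroup M] [Module ℤ M] : Type _ :=
  LocalizedModule (Ideal.span {(l : ℤ)}).primeCompl M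

/-- The localization `f_(ℓ)` of a homomorphism. -/
noncomputable abbrev locMap (l : ℕ) [Fact l.Prime] {M N : Type*} [AddCommGroup M] [AddCommGroup N]
    [Module ℤ M] [Module ℤ N] (f : M →ₗ[ℤ] N) :
    Loc l M →ₗ[Localization.AtPrime (Ideal.span {(l : ℤ)})] Loc l N :=
  LocalizedModule.map (Ideal.span {(l : ℤ)}).primeCompl f

end Localization

end QuandleSchur

/-!
The homomorphism `T` is already surjective before localization, and its kernel consists of
elements killed by integers prime to `l`; this is what makes the localized map bijective.

For `X` connected, `H²_Q(X; A)` is identified by `walk` with the homomorphisms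
`f : StabAs x₀ → A` that vanish on `gen x₀` (`quandleToStab_injective`, `exists_quandleToStab_eq`):
a 2-cocycle is rebuilt from `f` by choosing for each `x` an element of `As X` that carries `x₀`
to `x`. Under this identification `T` is the transgression of the restriction of `f` to `Ker ψ`.

*Kernel.* If this transgression vanishes, the five-term exact sequence extends the restriction of
`f` to a homomorphism `As X → A`, which is `g ↦ ε(g) a` because all generators are conjugate.
With `t = Type(X)`, the element `gen x₀ ^ t` lies in `Ker ψ` and `f` kills it, so `t a = 0` and
`t f` vanishes on `Ker ψ`. Hence `t f` comes from `H¹(Stab x₀; A)`, whose elements are killed by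
integers prime to `l`, and `t` is prime to `l` (`exists_smul_eq_zero_of_T_eq_zero`).

*Surjectivity.* A relative cocycle `(h, k)` gives a central extension of `Inn X` by `A`, with a
splitting over `Stab x₀` given by `k`. As `ψ(gen x₀)` is central in `Stab x₀`, the lifts of
elements of `Stab x₀` commute with a lift of `ψ(gen x₀)`, so the conjugates of that lift depend
only on the corresponding point of `X`; they define a homomorphism from `As X` to the extension
lifting `ψ` (`exists_asLift_cocycle`). Comparing it with the splitting over `Stab x₀` gives a
homomorphism on `StabAs x₀` whose transgression is the class of `h` (`T_surjective`).

The hypothesis on `H¹(Stab x₀; A)` says that the kernel of the projection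
`H²(Inn X, Stab x₀; A) → H²(Inn X, Stab x₀; A) / H¹(Stab x₀; A)` is torsion prime to `l` as well,
whence the first assertion.
-/

namespace QuandleSchur

/-! ### The five-term exact sequence -/

section FiveTerm

variable {G Q A : Type*} [Group G] [Group Q] [AddCommGroup A]

theorem H1_one (f : H1 G A) : f.1 1 = 0 := by
  have h := H1_mul f 1 1
  rw [mul_one] at h
  exact left_eq_add.1 h

theorem H1_inv (f : H1 G A) (g : G) : f.1 g⁻¹ = -f.1 g := by
  rw [eq_neg_iff_add_eq_zero, ← H1_mul, inv_mul_cancel, H1_one]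

theorem H1_pow (f : H1 G A) (g : G) (n : ℕ) : f.1 (g ^ n) = n • f.1 g := by
  induction n with
  | zero => rw [pow_zero, H1_one, zero_smul]
  | succ n ih => rw [pow_succ, H1_mul, ih, succ_nsmul]

variable (q : G →* Q) (hq : Function.Surjective q) (hc : q.ker ≤ Subgroup.center G)

theorem transgression_eq_mk_iff (F : H1 q.ker A) (h : LinearMap.ker (d2 Q A)) :
    transgression q hq hc A F = Submodule.Quotient.mk h ↔
      ∃ w : Q → A, ∀ x y, F.1 (factorSet q hq x y) = h.1 x y + (w y - w (x * y) + w x) := by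
  refine (Submodule.Quotient.eq _).trans ⟨?_, ?_⟩
  · rintro ⟨w, hw⟩
    refine ⟨w, fun x y => ?_⟩
    have e : w y - w (x * y) + w x = F.1 (factorSet q hq x y) - h.1 x y :=
      congrFun (congrFun hw x) y
    rw [e]; abel
  · rintro ⟨w, hw⟩
    refine ⟨w, ?_⟩
    funext x y
    change w y - w (x * y) + w x = F.1 (factorSet q hq x y) - h.1 x y
    rw [hw]; abel

/-- Exactness of the five-term sequence at `Hom(Ker q, A)`. -/
theorem exists_extension_of_transgression_eq_zero (F : H1 q.ker A)
    (h0 : transgression q hq hc A F = 0) : ∃ F' : H1 G A, ∀ z : q.ker, F'.1 z = F.1 z := by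
  obtain ⟨w, hw⟩ := (transgression_eq_mk_iff q hq hc F 0).1
    (h0.trans (Submodule.Quotient.mk_zero _).symm)
  replace hw : ∀ x y, F.1 (factorSet q hq x y) = w y - w (x * y) + w x := fun x y =>
    (hw x y).trans (zero_add _)
  have hs : ∀ x, q (Function.surjInv hq x) = x := Function.surjInv_eq hq
  let z : G → q.ker := fun g => ⟨g * (Function.surjInv hq (q g))⁻¹, by
    rw [MonoidHom.mem_ker, map_mul, map_inv, hs, mul_inv_cancel]⟩
  have hz : ∀ g g', z (g * g') = z g * z g' * factorSet q hq (q g) (q g') := fun g g' => by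
    apply Subtype.ext
    have hcomm := Subgroup.mem_center_iff.1 (hc (z g').2) (Function.surjInv hq (q g))
    change g * g' * (Function.surjInv hq (q (g * g')))⁻¹ = (z g : G) * z g' *
      (Function.surjInv hq (q g) * Function.surjInv hq (q g') *
        (Function.surjInv hq (q g * q g'))⁻¹)
    calc g * g' * (Function.surjInv hq (q (g * g')))⁻¹
        = (z g : G) * (Function.surjInv hq (q g) * z g') * Function.surjInv hq (q g') *
          (Function.surjInv hq (q g * q g'))⁻¹ := by
          simp only [z, map_mul]; group
      _ = _ := by rw [hcomm]; simp only [mul_assoc]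
  refine ⟨⟨fun g => F.1 (z g) + w (q g), mem_H1 fun g g' => ?_⟩, fun k => ?_⟩
  · rw [hz, H1_mul, H1_mul, hw, map_mul]; abel
  · have hk : q k = 1 := k.2
    have e : z k * factorSet q hq 1 1 = k := by
      apply Subtype.ext
      simp [z, factorSet, hk]
    have h1 := hw 1 1
    rw [mul_one, sub_self, zero_add] at h1
    change F.1 (z k) + w (q k) = F.1 k
    rw [hk, ← h1, ← H1_mul, e]

end FiveTerm

/-! ### Quandle 2-cocycles and homomorphisms on the stabilizer in `As X` -/

section QuandleCocycles

variable {X : Type*} [Quandle X] {A : Type*} [AddCommGroup A]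

theorem innAct_psi_gen (x y : X) : innAct x (psi X (gen y)) = rop x y := by
  rw [psi_gen]; rfl

theorem exists_innAct_psi_eq (hX : IsConnectedQuandle X) (x y : X) :
    ∃ g : As X, innAct x (psi X g) = y := by
  obtain ⟨g, hg⟩ := hX x y
  obtain ⟨g', rfl⟩ := psi_surjective X g
  exact ⟨g', hg⟩

theorem mem_StabAs {x : X} {g : As X} : g ∈ StabAs x ↔ innAct x (psi X g) = x := Iff.rfl

theorem innAct_psi_inv {x y : X} {g : As X} (h : innAct x (psi X g) = y) :
    innAct y (psi X g⁻¹) = x := by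
  rw [← h, ← innAct_mul, ← map_mul, mul_inv_cancel, map_one, innAct_one]

theorem mul_inv_mem_StabAs {x y : X} {g g' : As X} (h : innAct x (psi X g) = y)
    (h' : innAct x (psi X g') = y) : g * g'⁻¹ ∈ StabAs x := by
  rw [mem_StabAs, map_mul, innAct_mul, h, innAct_psi_inv h']

theorem quandleToStab_injective (hX : IsConnectedQuandle X) (x₀ : X) :
    Function.Injective (quandleToStab x₀ A) := by
  rw [← LinearMap.ker_eq_bot, LinearMap.ker_eq_bot']
  intro m hm
  obtain ⟨φ, rfl⟩ := Submodule.Quotient.mk_surjective _ m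
  have h0 : ∀ g ∈ StabAs x₀, walk φ x₀ g = 0 := fun g hg =>
    congrFun (congrArg Subtype.val hm) ⟨g, hg⟩
  choose s hs using exists_innAct_psi_eq hX x₀
  have hwd : ∀ g x, innAct x₀ (psi X g) = x → walk φ x₀ g = walk φ x₀ (s x) := fun g x hg => by
    have hmem := mul_inv_mem_StabAs hg (hs x)
    have e := walk_mul φ x₀ (g * (s x)⁻¹) (s x)
    rwa [inv_mul_cancel_right, h0 _ hmem, zero_add, mem_StabAs.1 hmem] at e
  refine (Submodule.Quotient.mk_eq_zero _).2 ⟨fun x => -walk φ x₀ (s x), ?_⟩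
  apply Subtype.ext
  funext x y
  change -walk φ x₀ (s x) - -walk φ x₀ (s (rop x y)) = φ.1.1 x y
  rw [← hwd (s x * gen y) (rop x y) (by rw [map_mul, innAct_mul, hs, innAct_psi_gen]), walk_mul,
    hs, walk_gen]
  abel

/-- The cocycle whose walks from `x₀` are given by `f` is `(x, y) ↦ f(s(x) e_y s(x ⋆ y)⁻¹)`, for
a choice of elements `s(x)` that carry `x₀` to `x`. -/
theorem exists_quandleToStab_eq (hX : IsConnectedQuandle X) (x₀ : X) (f : H1 (StabAs x₀) A)
    (hf : f.1 ⟨gen x₀, gen_mem_StabAs x₀⟩ = 0) : ∃ c : H2Q X A, quandleToStab x₀ A c = f := by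
  choose s hs using exists_innAct_psi_eq hX x₀
  have hmem : ∀ (x : X) (g : As X), s x * g * (s (innAct x (psi X g)))⁻¹ ∈ StabAs x₀ :=
    fun x g => mul_inv_mem_StabAs (by rw [map_mul, innAct_mul, hs]) (hs _)
  let W : X → As X → A := fun x g => f.1 ⟨_, hmem x g⟩
  have hW : ∀ x g h, W x (g * h) = W x g + W (innAct x (psi X g)) h := fun x g h => by
    simp only [W]
    rw [← H1_mul]
    refine congrArg f.1 (Subtype.ext ?_)
    simp only [Subgroup.coe_mul, map_mul, innAct_mul]
    group
  have hdiag : ∀ a, W a (gen a) = 0 := fun a => by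
    rw [← hf]
    refine congrArg f.1 (Subtype.ext ?_)
    have e := gen_act x₀ (s a)
    rw [hs] at e
    have ha : innAct a (psi X (gen a)) = a := gen_mem_StabAs a
    change s a * gen a * (s (innAct a (psi X (gen a))))⁻¹ = gen x₀
    rw [ha, ← e, mul_inv_cancel_right]
  let φ₀ : C2Q X A := ⟨fun x y => W x (gen y), hdiag⟩
  have hφ₀ : φ₀ ∈ LinearMap.ker (dQ2 X A) := by
    rw [LinearMap.mem_ker]
    funext x y z
    change W x (gen z) - W (rop x y) (gen z) - W x (gen y) + W (rop x z) (gen (rop y z)) = 0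
    have e := congrArg (W x) (gen_mul y z)
    rw [hW, hW, innAct_psi_gen, innAct_psi_gen] at e
    have e' : W (rop x z) (gen (rop y z)) =
        W x (gen y) + W (rop x y) (gen z) - W x (gen z) := by rw [e]; abel
    rw [e']; abel
  have hwalk : ∀ (g : As X) (x : X), walk ⟨φ₀, hφ₀⟩ x g = W x g := by
    have hone : ∀ x, W x 1 = 0 := fun x => by
      have e := hW x 1 1
      rw [mul_one, map_one, innAct_one] at e
      exact left_eq_add.1 e
    intro g
    refine as_induction (P := fun g => ∀ x, walk ⟨φ₀, hφ₀⟩ x g = W x g) ?_ ?_ ?_ ?_ g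
    · intro x; rw [walk_one, hone]
    · intro g h hg hh x; rw [walk_mul, hW, hg, hh]
    · intro y x; rw [walk_gen]
    · intro y x
      have e := hW x (gen y)⁻¹ (gen y)
      have e' := walk_mul ⟨φ₀, hφ₀⟩ x (gen y)⁻¹ (gen y)
      rw [inv_mul_cancel, walk_one, walk_gen] at e'
      rw [inv_mul_cancel, hone] at e
      exact add_right_cancel (e'.symm.trans e)
  refine ⟨Submodule.Quotient.mk ⟨φ₀, hφ₀⟩, Subtype.ext (funext fun g => ?_)⟩
  change walk ⟨φ₀, hφ₀⟩ x₀ g = f.1 g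
  have hg : innAct x₀ (psi X g.1) = x₀ := g.2
  let a : StabAs x₀ := ⟨s x₀, hs x₀⟩
  have e : (⟨_, hmem x₀ g⟩ : StabAs x₀) = a * g * a⁻¹ := by
    apply Subtype.ext
    simp only [hg]
    rfl
  rw [hwalk]
  change f.1 ⟨_, hmem x₀ g⟩ = f.1 g
  rw [e, H1_mul, H1_mul, H1_inv]; abel

theorem quandleToStab_gen (x₀ : X) (c : H2Q X A) :
    (quandleToStab x₀ A c).1 ⟨gen x₀, gen_mem_StabAs x₀⟩ = 0 := by
  obtain ⟨φ, rfl⟩ := Submodule.Quotient.mk_surjective _ c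
  change walk φ x₀ (gen x₀) = 0
  rw [walk_gen]
  exact φ.1.2 x₀

theorem epsilon_gen (x : X) : epsilon X (gen x) = Multiplicative.ofAdd 1 := asLift_gen _ _ x

theorem projStar_eq_self (x₀ : X) (f : H1 (StabAs x₀) A)
    (hf : f.1 ⟨gen x₀, gen_mem_StabAs x₀⟩ = 0) : projStar x₀ A f = f := by
  apply Subtype.ext
  funext g
  change f.1 g - (epsilon X g).toAdd • f.1 ⟨gen x₀, gen_mem_StabAs x₀⟩ = f.1 g
  rw [hf, smul_zero, sub_zero]

/-- The generators of `As X` are conjugate for `X` connected, so a homomorphism to an abelian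
group factors through `ε`. -/
theorem H1_As_eq (hX : IsConnectedQuandle X) (x₀ : X) (F : H1 (As X) A) (g : As X) :
    F.1 g = (epsilon X g).toAdd • F.1 (gen x₀) := by
  have hgen : ∀ x, F.1 (gen x) = F.1 (gen x₀) := fun x => by
    obtain ⟨g, hg⟩ := exists_innAct_psi_eq hX x₀ x
    have e := congrArg F.1 (gen_act x₀ g)
    rw [hg, H1_mul, H1_mul, add_comm] at e
    exact (add_left_cancel e).symm
  refine as_induction (P := fun g => F.1 g = (epsilon X g).toAdd • F.1 (gen x₀)) ?_ ?_ ?_ ?_ g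
  · rw [H1_one, map_one, toAdd_one, zero_smul]
  · intro g h hg hh
    rw [H1_mul, hg, hh, map_mul, toAdd_mul, add_smul]
  · intro x
    rw [hgen, epsilon_gen, toAdd_ofAdd, one_smul]
  · intro x
    rw [H1_inv, hgen, map_inv, epsilon_gen, toAdd_inv, toAdd_ofAdd, neg_smul, one_smul]

theorem pBar_T (x₀ : X) (c : H2Q X A) :
    pBar (Stab x₀) A (T x₀ A c) = transgression (psi X) (psi_surjective X) (psi_ker_central X) A
      (H1map A (Subgroup.inclusion (ker_le_StabAs x₀)) (quandleToStab x₀ A c)) := by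
  conv_rhs => rw [← projStar_eq_self x₀ _ (quandleToStab_gen x₀ c)]
  exact congrArg Subtype.val ((LinearEquiv.ofInjective (pBar (Stab x₀) A)
    (pBar_injective (Stab x₀) A)).apply_symm_apply _)

end QuandleCocycles

/-! ### The kernel of `T` -/

section Kernel

variable {X : Type*} [Quandle X] {A : Type*} [AddCommGroup A]

/-- `type X` is `0` if the type of `X` is infinite, but then the claim is trivial. -/
theorem gen_pow_type_mem_ker (x : X) : gen x ^ type X ∈ (psi X).ker := by
  rcases Nat.eq_zero_or_pos (type X) with h0 | hpos
  · rw [h0, pow_zero]; exact one_mem _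
  have hmem := (Nat.sInf_mem (Nat.nonempty_of_pos_sInf hpos)).2
  have key : ∀ (n : ℕ) (z : X), innAct z (psi X (gen x ^ n)) = (fun z => rop z x)^[n] z := by
    intro n
    induction n with
    | zero => intro z; rw [pow_zero, map_one]; rfl
    | succ n ih =>
      intro z
      rw [pow_succ', map_mul, innAct_mul, innAct_psi_gen, ih, Function.iterate_succ_apply]
  rw [MonoidHom.mem_ker]
  apply Subtype.ext
  apply MulOpposite.unop_injective
  apply Equiv.ext
  intro z
  exact (key (type X) z).trans (hmem z x)

theorem exists_smul_eq_zero_of_T_eq_zero (hX : IsConnectedQuandle X) (x₀ : X)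
    (S : Submonoid ℤ) (hS : ∀ k : H1 (Stab x₀) A, ∃ r ∈ S, r • k = 0)
    (ht : (type X : ℤ) ∈ S) (c : H2Q X A) (hc : T x₀ A c = 0) : ∃ r ∈ S, r • c = 0 := by
  have h0 := pBar_T x₀ c
  rw [hc, map_zero] at h0
  obtain ⟨F, hF⟩ := exists_extension_of_transgression_eq_zero _ _ _ _ h0.symm
  have hgen := quandleToStab_gen x₀ c
  set f : H1 (StabAs x₀) A := quandleToStab x₀ A c with hf
  have hF' : ∀ (z : As X) (hz : z ∈ (psi X).ker), F.1 z = f.1 ⟨z, ker_le_StabAs x₀ hz⟩ :=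
    fun z hz => hF ⟨z, hz⟩
  have hta : (type X : ℤ) • F.1 (gen x₀) = 0 := by
    rw [natCast_zsmul, ← H1_pow, hF' _ (gen_pow_type_mem_ker x₀)]
    have e := H1_pow f ⟨gen x₀, gen_mem_StabAs x₀⟩ (type X)
    rw [hgen, smul_zero] at e
    exact e
  have hker : ∀ (z : StabAs x₀), psi X z = 1 → (type X : ℤ) • f.1 z = 0 := fun z hz => by
    have e := hF' z hz
    rw [H1_As_eq hX x₀ F] at e
    rw [show f.1 z = _ from e.symm, smul_comm, hta, smul_zero]
  -- `type X • f` descends along `StabAs x₀ → Stab x₀`.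
  choose s hs using psi_surjective X
  let t : Stab x₀ → StabAs x₀ := fun b => ⟨s b, by
    rw [Subgroup.mem_comap, hs]; exact b.2⟩
  have hwd : ∀ g g' : StabAs x₀, psi X g = psi X g' →
      (type X : ℤ) • f.1 g = (type X : ℤ) • f.1 g' := fun g g' h => by
    have e := hker (g * g'⁻¹) (by
      rw [Subgroup.coe_mul, map_mul, h, Subgroup.coe_inv, map_inv, mul_inv_cancel])
    rwa [H1_mul, H1_inv, smul_add, smul_neg, ← sub_eq_add_neg, sub_eq_zero] at e
  let k : H1 (Stab x₀) A := ⟨fun b => (type X : ℤ) • f.1 (t b), mem_H1 fun b b' => by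
    rw [← smul_add, ← H1_mul]
    refine hwd _ _ ?_
    change psi X (s (b * b' : Stab x₀)) = psi X (s b * s b')
    rw [map_mul, hs, hs, hs]; rfl⟩
  obtain ⟨r, hr, hrk⟩ := hS k
  refine ⟨r * type X, S.mul_mem hr ht, quandleToStab_injective hX x₀ ?_⟩
  rw [map_zero, map_smul, ← hf]
  apply Subtype.ext
  funext g
  have e : r • k.1 ⟨psi X g, g.2⟩ = 0 := congrFun (congrArg Subtype.val hrk) ⟨psi X g, g.2⟩
  change (r * (type X : ℤ)) • f.1 g = 0
  rw [mul_smul, ← e]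
  exact congrArg (r • ·) (hwd _ _ (hs _).symm)

end Kernel

/-! ### Surjectivity of `T` -/

section CentralExtension

variable {Q A : Type*} [Group Q] [AddCommGroup A]

/-- The underlying set `A × Q` of the central extension of `Q` by `A` with factor set `h`. The
cocycle `h` need not be normalized, so the unit is `(-h(1, 1), 1)`. -/
@[ext]
structure CocycleExt (h : LinearMap.ker (d2 Q A)) where
  /-- The component in `A`. -/
  fst : A
  /-- The image in `Q`. -/
  snd : Q

namespace CocycleExt

theorem cocycle (h : LinearMap.ker (d2 Q A)) (x y z : Q) :
    h.1 x y + h.1 (x * y) z = h.1 y z + h.1 x (y * z) := by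
  have e : h.1 y z - h.1 (x * y) z + h.1 x (y * z) - h.1 x y = 0 :=
    congrFun (congrFun (congrFun (LinearMap.mem_ker.1 h.2) x) y) z
  rw [← sub_eq_zero, ← neg_eq_zero, ← e]; abel

theorem cocycle_one (h : LinearMap.ker (d2 Q A)) (x : Q) : h.1 1 x = h.1 1 1 := by
  have e := cocycle h 1 1 x
  rw [one_mul, one_mul] at e
  exact (add_right_cancel e).symm

variable {h : LinearMap.ker (d2 Q A)}

/-- `(a, x) (b, y) = (a + b + h(x, y), x y)`. -/
instance : Group (CocycleExt h) :=
  letI : Mul (CocycleExt h) := ⟨fun p r => ⟨p.fst + r.fst + h.1 p.snd r.snd, p.snd * r.snd⟩⟩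
  letI : One (CocycleExt h) := ⟨⟨-h.1 1 1, 1⟩⟩
  letI : Inv (CocycleExt h) := ⟨fun p => ⟨-p.fst - h.1 p.snd⁻¹ p.snd - h.1 1 1, p.snd⁻¹⟩⟩
  Group.ofLeftAxioms
    (fun p r t => by
      refine CocycleExt.ext ?_ (mul_assoc p.snd r.snd t.snd)
      change p.fst + r.fst + h.1 p.snd r.snd + t.fst + h.1 (p.snd * r.snd) t.snd =
        p.fst + (r.fst + t.fst + h.1 r.snd t.snd) + h.1 p.snd (r.snd * t.snd)
      have e := cocycle h p.snd r.snd t.snd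
      rw [← sub_eq_zero] at e ⊢
      rw [← e]; abel)
    (fun p => by
      refine CocycleExt.ext ?_ (one_mul p.snd)
      change -h.1 1 1 + p.fst + h.1 1 p.snd = p.fst
      rw [cocycle_one h p.snd, add_right_comm, neg_add_cancel, zero_add])
    (fun p => by
      refine CocycleExt.ext ?_ (inv_mul_cancel p.snd)
      change -p.fst - h.1 p.snd⁻¹ p.snd - h.1 1 1 + p.fst + h.1 p.snd⁻¹ p.snd = -h.1 1 1
      abel)

theorem mul_fst (p r : CocycleExt h) : (p * r).fst = p.fst + r.fst + h.1 p.snd r.snd := rfl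

theorem mul_snd (p r : CocycleExt h) : (p * r).snd = p.snd * r.snd := rfl

/-- The projection of the central extension to `Q`. -/
def proj (h : LinearMap.ker (d2 Q A)) : CocycleExt h →* Q := MonoidHom.mk' snd mul_snd

end CocycleExt

end CentralExtension

section Surjectivity

variable {X : Type*} [Quandle X] {A : Type*} [AddCommGroup A]

/-- The generator `e_{x₀}` is central in the stabilizer of `x₀`. -/
theorem psi_gen_comm_of_mem_Stab {x₀ : X} {b : Inn X} (hb : b ∈ Stab x₀) :
    psi X (gen x₀) * b = b * psi X (gen x₀) := by
  obtain ⟨g, rfl⟩ := psi_surjective X b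
  have e := gen_act x₀ g
  rw [show innAct x₀ (psi X g) = x₀ from hb] at e
  rw [← map_mul, e, map_mul]

/-- If the restriction of the cocycle `h` to `Stab x₀` is a coboundary, then the class of `h`
vanishes in `H²(As X; A)`. -/
theorem exists_asLift_cocycle (hX : IsConnectedQuandle X) (x₀ : X)
    (h : LinearMap.ker (d2 (Inn X) A)) (k : Stab x₀ → A)
    (hk : ∀ b b' : Stab x₀, h.1 b b' = k b' - k (b * b') + k b) :
    ∃ v : As X → A, ∀ g g', v (g * g') = v g + v g' + h.1 (psi X g) (psi X g') := by
  choose s hs using exists_innAct_psi_eq hX x₀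
  let lift : As X → CocycleExt h := fun g => ⟨0, psi X g⟩
  let E : X → CocycleExt h := fun x => (lift (s x))⁻¹ * lift (gen x₀) * lift (s x)
  -- `k` makes `h` symmetric on commuting elements of `Stab x₀`.
  have hstab : ∀ p : CocycleExt h, p.snd ∈ Stab x₀ → lift (gen x₀) * p = p * lift (gen x₀) := by
    intro p hp
    let b : Stab x₀ := ⟨psi X (gen x₀), gen_mem_StabAs x₀⟩
    let b' : Stab x₀ := ⟨p.snd, hp⟩
    have hbb : b * b' = b' * b := Subtype.ext (psi_gen_comm_of_mem_Stab hp)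
    have e1 := hk b b'
    have e2 := hk b' b
    refine CocycleExt.ext ?_ (congrArg Subtype.val hbb)
    rw [CocycleExt.mul_fst, CocycleExt.mul_fst]
    change 0 + p.fst + h.1 b b' = p.fst + 0 + h.1 b' b
    rw [e1, e2, hbb]; abel
  have hwd : ∀ (p : CocycleExt h) (x : X), innAct x₀ p.snd = x →
      lift (gen x₀) * p = p * E x := by
    intro p x hp
    have hmem : (p * (lift (s x))⁻¹).snd ∈ Stab x₀ := by
      have e : (p * (lift (s x))⁻¹).snd = p.snd * psi X (s x)⁻¹ := by
        change CocycleExt.proj h (p * (lift (s x))⁻¹) = _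
        rw [map_mul, map_inv, map_inv]; rfl
      rw [e]
      change innAct x₀ (p.snd * psi X (s x)⁻¹) = x₀
      rw [innAct_mul, hp, innAct_psi_inv (hs x)]
    have e := congrArg (· * lift (s x)) (hstab _ hmem)
    simp only [E]
    simpa only [mul_assoc, inv_mul_cancel, mul_one] using e
  have hE : ∀ x, (E x).snd = psi X (gen x) := fun x => by
    have e := congrArg CocycleExt.snd (hwd (lift (s x)) x (hs x))
    rw [CocycleExt.mul_snd, CocycleExt.mul_snd] at e
    change psi X (gen x₀) * psi X (s x) = psi X (s x) * (E x).snd at e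
    rw [← map_mul, gen_act, hs, map_mul] at e
    exact (mul_left_cancel e).symm
  let Θ : As X →* CocycleExt h := asLift E fun x y => by
    have e1 := hwd (lift (s x) * E y) (rop x y) (by
      rw [CocycleExt.mul_snd, innAct_mul, hE]
      change innAct (innAct x₀ (psi X (s x))) _ = _
      rw [hs, innAct_psi_gen])
    rw [← mul_assoc, hwd (lift (s x)) x (hs x), mul_assoc (lift (s x)),
      mul_assoc (lift (s x))] at e1
    exact mul_left_cancel e1
  have hΘ : ∀ g, (Θ g).snd = psi X g := fun g => by
    change ((CocycleExt.proj h).comp Θ) g = psi X g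
    refine as_induction (P := fun g => ((CocycleExt.proj h).comp Θ) g = psi X g) ?_ ?_ ?_ ?_ g
    · rw [map_one, map_one]
    · intro g g' hg hg'; rw [map_mul, map_mul, hg, hg']
    · intro x
      rw [MonoidHom.comp_apply, asLift_gen]; exact hE x
    · intro x
      rw [map_inv, map_inv, MonoidHom.comp_apply, asLift_gen]
      exact congrArg (·⁻¹) (hE x)
  refine ⟨fun g => (Θ g).fst, fun g g' => ?_⟩
  have e := congrArg CocycleExt.fst (map_mul Θ g g')
  rwa [CocycleExt.mul_fst, hΘ, hΘ] at e

theorem T_surjective (hX : IsConnectedQuandle X) (x₀ : X) :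
    Function.Surjective (T x₀ A) := by
  intro m
  obtain ⟨m, rfl⟩ := Submodule.Quotient.mk_surjective _ m
  obtain ⟨⟨⟨h, k⟩, hc⟩, rfl⟩ := Submodule.Quotient.mk_surjective _ m
  have hh : h ∈ LinearMap.ker (d2 (Inn X) A) := congrArg Prod.fst hc
  have hk : ∀ b b' : Stab x₀, h b b' = k b' - k (b * b') + k b := fun b b' =>
    sub_eq_zero.1 (congrFun (congrFun (congrArg Prod.snd hc) b) b')
  obtain ⟨v, hv⟩ := exists_asLift_cocycle hX x₀ ⟨h, hh⟩ k hk
  replace hv : ∀ g g', v (g * g') = v g + v g' + h (psi X g) (psi X g') := hv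
  -- The splittings of the extension over `StabAs x₀` given by `v` and by `k` differ by `f'`.
  let f' : H1 (StabAs x₀) A :=
    ⟨fun g => v g + k ⟨psi X g, g.2⟩, mem_H1 fun g g' => by
      have e := hk ⟨psi X g, g.2⟩ ⟨psi X g', g'.2⟩
      have e' : (⟨psi X (g * g' : StabAs x₀), (g * g').2⟩ : Stab x₀) =
          ⟨psi X g, g.2⟩ * ⟨psi X g', g'.2⟩ := Subtype.ext (map_mul (psi X) _ _)
      rw [e', Subgroup.coe_mul, hv]
      simp only at e
      rw [e]; abel⟩
  obtain ⟨c, hcf⟩ := exists_quandleToStab_eq hX x₀ (projStar x₀ A f') (by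
    change f'.1 _ - (epsilon X (gen x₀)).toAdd • f'.1 _ = 0
    rw [epsilon_gen, toAdd_ofAdd, one_smul, sub_self])
  refine ⟨c, pBar_injective (Stab x₀) A ?_⟩
  rw [pBar_T, hcf]
  change _ = Submodule.Quotient.mk (⟨h, hh⟩ : LinearMap.ker (d2 (Inn X) A))
  let a := f'.1 ⟨gen x₀, gen_mem_StabAs x₀⟩
  let σ : Inn X → As X := Function.surjInv (psi_surjective X)
  have hσ : ∀ x, psi X (σ x) = x := Function.surjInv_eq (psi_surjective X)
  refine (transgression_eq_mk_iff _ _ _ _ _).2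
    ⟨fun x => v (σ x) - (epsilon X (σ x)).toAdd • a, fun x y => ?_⟩
  set z := factorSet (psi X) (psi_surjective X) x y with hz
  have hmul : (z : As X) * σ (x * y) = σ x * σ y := by
    simp [hz, factorSet, σ]
  have hψ : psi X z = 1 := z.2
  have e1 : v z + v (σ (x * y)) + h 1 1 = v (σ x) + v (σ y) + h x y := by
    have e := congrArg v hmul
    rw [hv, hv, hψ, hσ, hσ, hσ] at e
    have e' : h 1 (x * y) = h 1 1 := CocycleExt.cocycle_one ⟨h, hh⟩ (x * y)
    rw [← e, e']
  have e2 : (epsilon X z).toAdd = (epsilon X (σ x)).toAdd + (epsilon X (σ y)).toAdd -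
      (epsilon X (σ (x * y))).toAdd := by
    have e := congrArg (fun g => (epsilon X g).toAdd) hmul
    simp only [map_mul, toAdd_mul] at e
    exact eq_sub_of_add_eq e
  have e3 : k ⟨psi X z, ker_le_StabAs x₀ z.2⟩ = h 1 1 := by
    have e : (⟨psi X z, ker_le_StabAs x₀ z.2⟩ : Stab x₀) = 1 := Subtype.ext hψ
    have e' := hk 1 1
    rw [mul_one, sub_self, zero_add] at e'
    rw [e, ← e']; rfl
  change v z + k ⟨psi X z, ker_le_StabAs x₀ z.2⟩ - (epsilon X z).toAdd • a =
    h x y + ((v (σ y) - (epsilon X (σ y)).toAdd • a) -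
      (v (σ (x * y)) - (epsilon X (σ (x * y))).toAdd • a) +
      (v (σ x) - (epsilon X (σ x)).toAdd • a))
  have e4 : v z = v (σ x) + v (σ y) + h x y - h 1 1 - v (σ (x * y)) := by
    rw [← e1]; abel
  rw [e3, e2, e4, sub_smul, add_smul]; abel

end Surjectivity

/-! ### Localization -/

section Localization

theorem localizedModule_map_injective {R M N : Type*} [CommRing R] [AddCommGroup M]
    [AddCommGroup N] [Module R M] [Module R N] (S : Submonoid R) (f : M →ₗ[R] N)
    (hf : ∀ m, f m = 0 → ∃ r ∈ S, r • m = 0) :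
    Function.Injective (LocalizedModule.map S f) := by
  rw [injective_iff_map_eq_zero]
  intro m hm
  induction m using LocalizedModule.induction_on with
  | h m s =>
    rw [LocalizedModule.map_mk, ← LocalizedModule.zero_mk 1, LocalizedModule.mk_eq, one_smul,
      smul_zero] at hm
    obtain ⟨r, hr⟩ := hm
    rw [smul_zero] at hr
    have hr' : f ((r : R) • m) = 0 := by rw [map_smul]; exact hr
    obtain ⟨r', hr', e⟩ := hf _ hr'
    rw [← LocalizedModule.zero_mk 1, LocalizedModule.mk_eq]
    refine ⟨⟨r', hr'⟩ * r, ?_⟩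
    rw [one_smul, smul_zero, smul_zero]
    change (r' * (r : R)) • m = 0
    rw [mul_smul, e]

end Localization

end QuandleSchur

theorem theorem3p2 {X : Type*} [Quandle X] (hX : QuandleSchur.IsConnectedQuandle X) (x₀ : X)
    (A : Type*) [AddCommGroup A] (l : ℕ) [Fact l.Prime]
    (hl : Nat.Coprime l (QuandleSchur.type X))
    (hStab : Subsingleton
      (QuandleSchur.Loc l (QuandleSchur.H1 (QuandleSchur.Stab x₀) A))) :
    Function.Bijective (QuandleSchur.locMap l
      (LinearMap.range (QuandleSchur.relDelta (QuandleSchur.Stab x₀) A)).mkQ) ∧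
    ∃ e : QuandleSchur.Loc l (QuandleSchur.H2Q X A)
        ≃ₗ[Localization.AtPrime (Ideal.span {(l : ℤ)})]
        QuandleSchur.Loc l (QuandleSchur.H2rel (QuandleSchur.Stab x₀) A),
      ∀ c, QuandleSchur.locMap l
          (LinearMap.range (QuandleSchur.relDelta (QuandleSchur.Stab x₀) A)).mkQ (e c) =
        QuandleSchur.locMap l (QuandleSchur.T x₀ A) c := by
  have hS : ∀ k : QuandleSchur.H1 (QuandleSchur.Stab x₀) A,
      ∃ r ∈ (Ideal.span {(l : ℤ)}).primeCompl, r • k = 0 :=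
    LocalizedModule.subsingleton_iff.1 hStab
  have ht : (QuandleSchur.type X : ℤ) ∈ (Ideal.span {(l : ℤ)}).primeCompl := fun h =>
    (Nat.Prime.coprime_iff_not_dvd Fact.out).1 hl
      (Int.natCast_dvd_natCast.1 (Ideal.mem_span_singleton.1 h))
  have hproj : Function.Bijective (QuandleSchur.locMap l
      (LinearMap.range (QuandleSchur.relDelta (QuandleSchur.Stab x₀) A)).mkQ) := by
    refine ⟨QuandleSchur.localizedModule_map_injective _ _ fun m hm => ?_,
      LocalizedModule.map_surjective _ _ (Submodule.mkQ_surjective _)⟩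
    obtain ⟨k, rfl⟩ := (Submodule.Quotient.mk_eq_zero _).1 hm
    obtain ⟨r, hr, hrk⟩ := hS k
    exact ⟨r, hr, by rw [← map_smul, hrk, map_zero]⟩
  have hT : Function.Bijective (QuandleSchur.locMap l (QuandleSchur.T x₀ A)) :=
    ⟨QuandleSchur.localizedModule_map_injective _ _
      (QuandleSchur.exists_smul_eq_zero_of_T_eq_zero hX x₀ _ hS ht),
      LocalizedModule.map_surjective _ _ (QuandleSchur.T_surjective hX x₀)⟩
  refine ⟨hproj, (LinearEquiv.ofBijective _ hT).trans (LinearEquiv.ofBijective _ hproj).symm,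
    fun c => ?_⟩
  exact (LinearEquiv.ofBijective _ hproj).apply_symm_apply _
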